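/- A Shapley (fair cost-sharing) network design game with $n$ players is given by a finite undirected graph $G=(V,E)$ with edge costs $c_e\ge 0$ and, for each player $i=1,\dots,n$, a source $s_i$ and a target $t_i$ that are connected in $G$. Player $i$ chooses a (simple) $s_i$-$t_i$ path $P_i$ and pays $\mathrm{cost}_i(P)=\sum_{e\in P_i}c_e/k_e(P)$, where $k_e(P)=|\{j: e\in P_j\}|$. The social cost of a profile $P=(P_1,\dots,P_n)$ is $\mathrm{cost}(P)=\sum_i\mathrm{cost}_i(P)$. A profile is a Nash equilibrium if no player can lower her cost by changing only her own path. The price of stability of a game is the ratio of the minimum social cost of a Nash equilibrium to the minimum social cost of any profile (where $0/0:=0$ and $a/0:=\infty$ for $a>0$), and $\mathrm{PoS}(n)$ is the supremum of the prices of stability of all such games with $n$ players. Let $H(k)=\int_0^1\frac{1-x^k}{1-x}\,dx$ for real $k\ge 0$; for a positive integer $k$ this is the harmonic number $H_k=\sum_{i=1}^k \frac1i$. **Theorem.** (a) For every $\varepsilon>0$ there is an $n(\varepsilon)$ such that, for all $n\ge n(\varepsilon)$, $$\mathrm{PoS}(n)\le H(n/2)+\varepsilon .$$ (b) For every $n\ge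 2$, with $x=\frac{n-H_n}{H_n-1}$, $$\mathrm{PoS}(n)\le \frac{n+x}{n+x-H_n}\,H\!\left(\frac{n+x}{2}\right).$$ -/

import Mathlib

open scoped ENNReal

universe u

/-- A Shapley network design game with `n` players on a simple undirected graph with vertex set `V`.
Only the values of `cost` on edges of the graph ever matter; they are non-negative. The terminals
of every player are connected in the graph, that is, every player has a strategy. -/
structure NetworkDesignGame (V : Type*) (n : ℕ) where
  graph : SimpleGraph V
  cost : Sym2 V → ℝ
  cost_nonneg : ∀ e ∈ graph.edgeSet, 0 ≤ cost e
  source : Fin n → V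
  target : Fin n → V
  reachable : ∀ i, graph.Reachable (source i) (target i)

namespace NetworkDesignGame

/-- A strategy profile: every player `i` chooses a (simple) path from her source to her target. -/
abbrev Profile {V : Type*} {n : ℕ} (Γ : NetworkDesignGame V n) : Type _ :=
  (i : Fin n) → Γ.graph.Path (Γ.source i) (Γ.target i)

open Classical in
/-- The set of edges on the path chosen by player `i`. -/
noncomputable def edges {V : Type*} {n : ℕ} (Γ : NetworkDesignGame V n) (P : Γ.Profile)
    (i : Fin n) : Finset (Sym2 V) :=
  (P i).1.edges.toFinset

open Classical in
/-- `k_e(P)`: the number of players that use the edge `e`. -/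
noncomputable def load {V : Type*} {n : ℕ} (Γ : NetworkDesignGame V n) (P : Γ.Profile)
    (e : Sym2 V) : ℕ :=
  (Finset.univ.filter fun j : Fin n => e ∈ Γ.edges P j).card

/-- The cost of player `i`: her fair shares of the costs of the edges on her path. -/
noncomputable def playerCost {V : Type*} {n : ℕ} (Γ : NetworkDesignGame V n) (P : Γ.Profile)
    (i : Fin n) : ℝ :=
  ∑ e ∈ Γ.edges P i, Γ.cost e / (Γ.load P e : ℝ)

/-- The social cost: the sum of the players' costs. -/
noncomputable def socialCost {V : Type*} {n : ℕ} (Γ : NetworkDesignGame V n)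
    (P : Γ.Profile) : ℝ :=
  ∑ i, Γ.playerCost P i

/-- (Pure) Nash equilibria: no player can lower her cost by a unilateral change of her path. -/
def IsNash {V : Type*} {n : ℕ} (Γ : NetworkDesignGame V n) (N : Γ.Profile) : Prop :=
  ∀ (i : Fin n) (Q : Γ.graph.Path (Γ.source i) (Γ.target i)),
    Γ.playerCost N i ≤ Γ.playerCost (Function.update N i Q) i

/-- The price of stability of a game: the least social cost of a Nash equilibrium over the least
social cost of a profile. On a finite graph there are finitely many profiles, so that the infima
are minima. They are taken in `ℝ≥0∞`, so that the value would be `∞` if there were no equilibrium,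
and, if the optimum costs `0`, it is `∞` unless some equilibrium costs `0` too (then it is `0`). -/
noncomputable def priceOfStability {V : Type*} {n : ℕ} (Γ : NetworkDesignGame V n) : ℝ≥0∞ :=
  (⨅ (N : Γ.Profile) (_ : Γ.IsNash N), ENNReal.ofReal (Γ.socialCost N)) /
    (⨅ P : Γ.Profile, ENNReal.ofReal (Γ.socialCost P))

end NetworkDesignGame

/-- `PoS(n)`: the supremum of the prices of stability of all games with `n` players on finite
undirected graphs. -/
noncomputable def PoS (n : ℕ) : ℝ≥0∞ :=
  ⨆ (V : Type u) (_ : Finite V) (Γ : NetworkDesignGame V n), Γ.priceOfStability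

/-- The harmonic numbers extended to real arguments. -/
noncomputable def realHarmonic (k : ℝ) : ℝ :=
  ∫ x in (0 : ℝ)..1, (1 - x ^ k) / (1 - x)

/-- The number `x = (n - H_n) / (H_n - 1)`. -/
noncomputable def shift (n : ℕ) : ℝ :=
  ((n : ℝ) - (harmonic n : ℝ)) / ((harmonic n : ℝ) - 1)

/-! Let N minimize Rosenthal's potential Φ; it is an equilibrium (`potential_update_sub`). Any
comparison profile may be replaced by a profile O in a forest, at no greater cost. For a fixed
player i, let every j whose forest path meets that of i travel to the terminals of i inside the
symmetric difference of the two forest paths and cross along N_i; the others keep their paths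
(`IsAcyclic.exists_path_of_le`). Off N_i, an edge of load k in O then carries at most n - k players
if O_i uses it and at most k otherwise. Sum the resulting bounds on Φ(N) over all i, and add x times
Φ(N) ≤ Φ(O). An edge of load k contributes at least n + x - H_n on the side of N, once the H_n terms
are moved there (`add_shift_sub_harmonic_le`), and at most (n + x) H((n + x)/2) on the side of O
(`mul_realHarmonic_add_mul_realHarmonic_le`); both estimates come from concavity of H. This is (b).
Since x = O(n / H_n), (a) follows. -/

/-! ### The harmonic function of a real argument -/

open MeasureTheory in
theorem intervalIntegrable_realHarmonic {k : ℝ} (hk : 0 ≤ k) :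
    IntervalIntegrable (fun x : ℝ => (1 - x ^ k) / (1 - x)) volume 0 1 := by
  rw [intervalIntegrable_iff_integrableOn_Ioc_of_le zero_le_one]
  refine Measure.integrableOn_of_bounded (M := (⌈k⌉₊ : ℝ)) (by simp) ?_ ?_
  · exact (by fun_prop : Measurable fun x : ℝ => (1 - x ^ k) / (1 - x)).aestronglyMeasurable
  · refine (ae_restrict_iff' measurableSet_Ioc).2 (Filter.Eventually.of_forall ?_)
    rintro x ⟨h0, h1⟩
    -- At x = 1 the integrand is 0, by division by zero.
    rcases h1.eq_or_lt with rfl | h1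
    · simp
    have hxk : x ^ k ≤ 1 := Real.rpow_le_one h0.le h1.le hk
    rw [Real.norm_of_nonneg (div_nonneg (by linarith) (by linarith)),
      div_le_iff₀ (by linarith)]
    have h2 : x ^ ⌈k⌉₊ ≤ x ^ k := by
      rw [← Real.rpow_natCast]
      exact Real.rpow_le_rpow_of_exponent_ge h0 h1.le (Nat.le_ceil k)
    have h3 : (∑ i ∈ Finset.range ⌈k⌉₊, x ^ i) ≤ ⌈k⌉₊ := by
      calc _ ≤ ∑ i ∈ Finset.range ⌈k⌉₊, (1 : ℝ) :=
            Finset.sum_le_sum fun i _ => pow_le_one₀ h0.le h1.le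
        _ = _ := by simp
    have h4 := geom_sum_mul x ⌈k⌉₊
    nlinarith

theorem realHarmonic_zero : realHarmonic 0 = 0 := by
  simp [realHarmonic]

theorem realHarmonic_add_one {y : ℝ} (hy : 0 ≤ y) :
    realHarmonic (y + 1) = realHarmonic y + 1 / (y + 1) := by
  have h : realHarmonic (y + 1) - realHarmonic y = ∫ x in (0 : ℝ)..1, x ^ y := by
    rw [realHarmonic, realHarmonic, ← intervalIntegral.integral_sub
      (intervalIntegrable_realHarmonic (by linarith)) (intervalIntegrable_realHarmonic hy)]
    refine intervalIntegral.integral_congr_Ioo_of_le zero_le_one ?_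
    rintro x ⟨h0, h1⟩
    have : (1 - x) ≠ 0 := by linarith
    have h2 : x ^ (y + 1) = x ^ y * x := by rw [Real.rpow_add h0, Real.rpow_one]
    simp only [h2]
    field_simp
    ring
  rw [integral_rpow (Or.inl (by linarith)), Real.one_rpow, Real.zero_rpow (by linarith)] at h
  simp at h ⊢
  linarith

theorem realHarmonic_natCast (n : ℕ) : realHarmonic n = harmonic n := by
  induction n with
  | zero => simp [realHarmonic_zero]
  | succ n ih =>
    rw [Nat.cast_succ, realHarmonic_add_one n.cast_nonneg, ih, harmonic_succ]
    simp

theorem realHarmonic_mono {a b : ℝ} (ha : 0 ≤ a) (hab : a ≤ b) :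
    realHarmonic a ≤ realHarmonic b := by
  refine intervalIntegral.integral_mono_on_of_le_Ioo zero_le_one
    (intervalIntegrable_realHarmonic ha) (intervalIntegrable_realHarmonic (ha.trans hab)) ?_
  rintro x ⟨h0, h1⟩
  have := Real.rpow_le_rpow_of_exponent_ge h0 h1.le hab
  exact div_le_div_of_nonneg_right (by linarith) (by linarith)

theorem realHarmonic_nonneg {a : ℝ} (ha : 0 ≤ a) : 0 ≤ realHarmonic a :=
  realHarmonic_zero ▸ realHarmonic_mono le_rfl ha

/-- For fixed x in (0, 1) the power x ^ k is convex in k; integrate. -/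
theorem concaveOn_realHarmonic : ConcaveOn ℝ (Set.Ici 0) realHarmonic := by
  refine ⟨convex_Ici 0, ?_⟩
  intro a ha b hb s t hs ht hst
  rw [Set.mem_Ici] at ha hb
  have hab : 0 ≤ s * a + t * b := by positivity
  simp only [smul_eq_mul]
  rw [realHarmonic, realHarmonic, realHarmonic, ← intervalIntegral.integral_const_mul,
    ← intervalIntegral.integral_const_mul, ← intervalIntegral.integral_add
    ((intervalIntegrable_realHarmonic ha).const_mul s)
    ((intervalIntegrable_realHarmonic hb).const_mul t)]
  refine intervalIntegral.integral_mono_on_of_le_Ioo zero_le_one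
    (((intervalIntegrable_realHarmonic ha).const_mul s).add
      ((intervalIntegrable_realHarmonic hb).const_mul t))
    (intervalIntegrable_realHarmonic hab) ?_
  rintro x ⟨h0, h1⟩
  have h2 : x ^ (s * a + t * b) ≤ s * x ^ a + t * x ^ b := by
    have := convexOn_exp.2 (Set.mem_univ (Real.log x * a)) (Set.mem_univ (Real.log x * b))
      hs ht hst
    rw [Real.rpow_def_of_pos h0, Real.rpow_def_of_pos h0, Real.rpow_def_of_pos h0]
    simp only [smul_eq_mul] at this
    rwa [show Real.log x * (s * a + t * b) = s * (Real.log x * a) + t * (Real.log x * b) by ring]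
  have h3 : s * ((1 - x ^ a) / (1 - x)) + t * ((1 - x ^ b) / (1 - x))
      = (1 - (s * x ^ a + t * x ^ b)) / (1 - x) := by
    rw [← mul_div_assoc, ← mul_div_assoc, ← add_div]
    congr 1
    linear_combination hst
  rw [h3]
  exact div_le_div_of_nonneg_right (by linarith) (by linarith)

/-- By concavity the slope to the right of y is at most the slope on [y - 1, y], which is 1 / y. -/
theorem realHarmonic_add_le {y d : ℝ} (hy : 1 ≤ y) (hd : 0 ≤ d) :
    realHarmonic (y + d) ≤ realHarmonic y + d / y := by
  rcases hd.eq_or_lt with rfl | hd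
  · simp
  have h1 := concaveOn_realHarmonic.slope_anti_adjacent (x := y - 1) (y := y) (z := y + d)
    (by simpa using hy) (by simp; linarith) (by linarith) (by linarith)
  have h2 := realHarmonic_add_one (y := y - 1) (by linarith)
  rw [sub_add_cancel] at h2
  rw [h2, sub_sub_cancel, add_sub_cancel_left, add_sub_cancel_left, div_one,
    div_le_iff₀ hd, ← h2] at h1
  calc realHarmonic (y + d) ≤ realHarmonic y + 1 / y * d := by linarith
    _ = _ := by ring

/-- Jensen's inequality at the points k and n - k with weights (n + x - k)/(n + x) and k/(n + x);
their mean is at most (n + x)/2. -/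
theorem mul_realHarmonic_add_mul_realHarmonic_le {k n x : ℝ} (hk : 0 ≤ k) (hkn : k ≤ n)
    (hx : 0 ≤ x) :
    (n + x - k) * realHarmonic k + k * realHarmonic (n - k) ≤
      (n + x) * realHarmonic ((n + x) / 2) := by
  rcases (by linarith : 0 ≤ n + x).eq_or_lt with h0 | h0
  · have h1 : k = 0 := by linarith
    simp [h1, realHarmonic_zero, ← h0]
  have hne := h0.ne'
  have hs : (n + x - k) / (n + x) + k / (n + x) = 1 := by field_simp; ring
  have h1 := concaveOn_realHarmonic.2 (show k ∈ Set.Ici 0 from hk)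
    (show n - k ∈ Set.Ici 0 by simpa using hkn)
    (show 0 ≤ (n + x - k) / (n + x) from div_nonneg (by linarith) h0.le)
    (show 0 ≤ k / (n + x) by positivity) hs
  simp only [smul_eq_mul] at h1
  have h2 : (n + x - k) / (n + x) * k + k / (n + x) * (n - k) ≤ (n + x) / 2 := by
    rw [div_mul_eq_mul_div, div_mul_eq_mul_div, ← add_div, div_le_iff₀ h0]
    nlinarith [sq_nonneg (n + x / 2 - 2 * k), mul_nonneg (hk.trans hkn) hx, sq_nonneg x]
  have h3 := h1.trans (realHarmonic_mono
    (add_nonneg (mul_nonneg (div_nonneg (by linarith) h0.le) hk)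
      (mul_nonneg (by positivity) (by linarith))) h2)
  calc _ = (n + x) * ((n + x - k) / (n + x) * realHarmonic k +
        k / (n + x) * realHarmonic (n - k)) := by field_simp
    _ ≤ _ := by gcongr

/-! ### Harmonic numbers and the choice of x -/

theorem harmonic_le_harmonic {a b : ℕ} (h : a ≤ b) : (harmonic a : ℝ) ≤ harmonic b := by
  rw [← realHarmonic_natCast, ← realHarmonic_natCast]
  exact realHarmonic_mono a.cast_nonneg (by exact_mod_cast h)

theorem one_lt_harmonic {n : ℕ} (hn : 2 ≤ n) : (1 : ℝ) < harmonic n := by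
  have h := realHarmonic_mono (a := 2) (b := n) (by norm_num) (by exact_mod_cast hn)
  have h2 := realHarmonic_natCast 2
  rw [realHarmonic_natCast] at h
  norm_num [harmonic, Finset.sum_range_succ] at h2
  rw [h2] at h
  linarith

theorem harmonic_le_self (n : ℕ) : (harmonic n : ℝ) ≤ n := by
  induction n with
  | zero => simp
  | succ n ih =>
    rw [harmonic_succ]
    push_cast
    have : ((n : ℝ) + 1)⁻¹ ≤ 1 := inv_le_one_of_one_le₀ (by linarith [n.cast_nonneg (α := ℝ)])
    linarith

theorem shift_nonneg {n : ℕ} (hn : 2 ≤ n) : 0 ≤ shift n :=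
  div_nonneg (by linarith [harmonic_le_self n]) (by linarith [one_lt_harmonic hn])

theorem shift_mul_harmonic {n : ℕ} (hn : 2 ≤ n) :
    shift n * harmonic n = n + shift n - harmonic n := by
  have := one_lt_harmonic hn
  have h : shift n * (harmonic n - 1) = n - harmonic n :=
    div_mul_cancel₀ _ (by linarith)
  linarith

theorem add_shift_sub_harmonic_pos {n : ℕ} (hn : 2 ≤ n) :
    0 < (n : ℝ) + shift n - harmonic n := by
  rcases (shift_nonneg hn).eq_or_lt with h | h
  · have h1 := shift_mul_harmonic hn
    have h3 : (harmonic n : ℝ) < n := by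
      obtain ⟨m, rfl⟩ : ∃ m, n = m + 1 := ⟨n - 1, by omega⟩
      rw [harmonic_succ]
      have := harmonic_le_self m
      push_cast
      have : ((m : ℝ) + 1)⁻¹ < 1 := by
        apply inv_lt_one_of_one_lt₀
        have : (1 : ℝ) ≤ m := by exact_mod_cast (by omega)
        linarith
      linarith
    linarith
  · rw [← shift_mul_harmonic hn]
    have := one_lt_harmonic hn
    positivity

/-- The right side is concave in k, hence minimal at k = 1 or k = n. The number x is chosen to make
these two values equal (`shift_mul_harmonic`). -/
theorem add_shift_sub_harmonic_le {n k : ℕ} (hn : 2 ≤ n) (hk : 1 ≤ k) (hkn : k ≤ n) :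
    (n : ℝ) + shift n - harmonic n ≤ (n + shift n) * harmonic k - k * harmonic n := by
  have hx := shift_nonneg hn
  have hc : ConcaveOn ℝ (Set.Ici 0)
      fun y : ℝ => (n + shift n) * realHarmonic y + -(harmonic n : ℝ) * y := by
    refine (concaveOn_realHarmonic.smul (by positivity : 0 ≤ (n : ℝ) + shift n)).add ?_
    exact (LinearMap.mul ℝ ℝ (-(harmonic n : ℝ))).concaveOn (convex_Ici 0)
  have h := hc.min_le_of_mem_Icc (x := 1) (y := (n : ℝ)) (z := (k : ℝ)) (by simp) (by simp)
    ⟨by exact_mod_cast hk, by exact_mod_cast hkn⟩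
  have h1 := realHarmonic_natCast 1
  simp only [Nat.cast_one, realHarmonic_natCast] at h h1
  rw [h1] at h
  have h2 := shift_mul_harmonic hn
  have h3 : harmonic 1 = 1 := by norm_num [harmonic]
  rw [h3, min_eq_left] at h
  · push_cast at h; linarith
  · push_cast; linarith

/-! ### Detours in forests -/

namespace SimpleGraph
variable {V : Type*} {G : SimpleGraph V}

/-- Cutting a walk at its first vertex in a set. -/
theorem Walk.exists_eq_append_of_mem_support {u v : V} (p : G.Walk u v) (S : Set V)
    (h : ∃ x ∈ p.support, x ∈ S) :
    ∃ (a : V) (p₁ : G.Walk u a) (p₂ : G.Walk a v), a ∈ S ∧ p = p₁.append p₂ ∧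
      ∀ x ∈ p₁.support, x ∈ S → x = a := by
  induction p with
  | nil =>
    obtain ⟨x, hx, hS⟩ := h
    simp only [Walk.support_nil, List.mem_singleton] at hx
    subst hx
    exact ⟨_, .nil, .nil, hS, rfl, by simp⟩
  | @cons u w v huw p ih =>
    by_cases hu : u ∈ S
    · exact ⟨u, .nil, .cons huw p, hu, rfl, by simp⟩
    · obtain ⟨x, hx, hS⟩ := h
      rw [Walk.support_cons, List.mem_cons] at hx
      obtain ⟨a, p₁, p₂, ha, rfl, h₁⟩ :=
        ih ⟨x, hx.resolve_left (by rintro rfl; exact hu hS), hS⟩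
      refine ⟨a, .cons huw p₁, p₂, ha, rfl, fun y hy hyS => ?_⟩
      rw [Walk.support_cons, List.mem_cons] at hy
      exact h₁ y (hy.resolve_left (by rintro rfl; exact hu hyS)) hyS

/-- Both ends of a common edge would have to be `a`. -/
theorem Walk.notMem_edges_of_forall_mem_support {u a s t : V} {p : G.Walk u a} {q : G.Walk s t}
    (h : ∀ x ∈ p.support, x ∈ q.support → x = a) {e : Sym2 V} (hp : e ∈ p.edges) :
    e ∉ q.edges := by
  intro hq
  induction e with
  | _ x y =>
    have hx := h x (p.fst_mem_support_of_mem_edges hp) (q.fst_mem_support_of_mem_edges hq)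
    have hy := h y (p.snd_mem_support_of_mem_edges hp) (q.snd_mem_support_of_mem_edges hq)
    exact (p.adj_of_mem_edges hp).ne (hx.trans hy.symm)

/-- Two paths of a forest that meet do so in a common segment; the rest of them lies in their
symmetric difference. -/
theorem IsAcyclic.exists_walks_of_mem_support (hG : G.IsAcyclic) {u v s t : V} {p : G.Walk u v}
    {q : G.Walk s t} (hp : p.IsPath) (hq : q.IsPath) (h : ∃ x ∈ p.support, x ∈ q.support) :
    (∃ (w₁ : G.Walk u s) (w₂ : G.Walk t v), ∀ e, e ∈ w₁.edges ∨ e ∈ w₂.edges →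
      ¬ (e ∈ q.edges ↔ e ∈ p.edges)) ∨
    ∃ (w₁ : G.Walk u t) (w₂ : G.Walk s v), ∀ e, e ∈ w₁.edges ∨ e ∈ w₂.edges →
      ¬ (e ∈ q.edges ↔ e ∈ p.edges) := by
  classical
  obtain ⟨a, p₁, p', ha, rfl, h₁⟩ := p.exists_eq_append_of_mem_support {x | x ∈ q.support} h
  -- Cutting the reversed rest of `p` finds the last vertex `b` of `p` on `q`.
  obtain ⟨b, p₃, p₂, hb, hp', h₃⟩ := p'.reverse.exists_eq_append_of_mem_support
    {x | x ∈ q.support} ⟨a, by simp, ha⟩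
  obtain rfl : p' = p₂.reverse.append p₃.reverse := by
    rw [← Walk.reverse_append, ← hp', Walk.reverse_reverse]
  simp only [Set.mem_ofPred_eq] at ha hb h₁ h₃
  have hp₂ : p₂.reverse.IsPath := hp.of_append_right.of_append_left
  -- The case in which `q` visits `a` before `b`; the other case is this one for `q.reverse`.
  have key : ∀ {s t : V} (q : G.Walk s t), q.IsPath → ∀ ha : a ∈ q.support,
      b ∈ (q.dropUntil a ha).support →
      (∀ x ∈ p₁.support, x ∈ q.support → x = a) → (∀ x ∈ p₃.support, x ∈ q.support → x = b) →
      ∃ (w₁ : G.Walk u s) (w₂ : G.Walk t v), ∀ e, e ∈ w₁.edges ∨ e ∈ w₂.edges →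
        ¬ (e ∈ q.edges ↔ e ∈ (p₁.append (p₂.reverse.append p₃.reverse)).edges) := by
    intro s t q hq ha hb h₁ h₃
    have hq' := q.take_spec ha
    have hq'' := (q.dropUntil a ha).take_spec hb
    set q₁ := q.takeUntil a ha
    set q₂ := (q.dropUntil a ha).takeUntil b hb
    set q₃ := (q.dropUntil a ha).dropUntil b hb
    rw [← hq''] at hq'
    have hq₂ : q₂.IsPath := by
      rw [← hq'] at hq
      exact hq.of_append_right.of_append_left
    -- Paths in a forest are unique, so `p` and `q` agree between `a` and `b`.
    have h₂ : p₂.reverse = q₂ :=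
      congrArg Subtype.val ((hG.subsingleton_path _ _).elim ⟨_, hp₂⟩ ⟨_, hq₂⟩)
    have hnd : (q₁.edges ++ (q₂.edges ++ q₃.edges)).Nodup := by
      have := hq.isTrail.edges_nodup
      rwa [← hq', Walk.edges_append, Walk.edges_append] at this
    have hqe : ∀ e, e ∈ q.edges ↔ e ∈ q₁.edges ∨ e ∈ q₂.edges ∨ e ∈ q₃.edges := by
      intro e
      rw [← hq', Walk.edges_append, Walk.edges_append, List.mem_append, List.mem_append]
    have hpe : ∀ e, e ∈ (p₁.append (p₂.reverse.append p₃.reverse)).edges ↔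
        e ∈ p₁.edges ∨ e ∈ q₂.edges ∨ e ∈ p₃.edges := by
      intro e
      rw [h₂, Walk.edges_append, Walk.edges_append, List.mem_append, List.mem_append,
        Walk.edges_reverse, List.mem_reverse]
    refine ⟨p₁.append q₁.reverse, q₃.reverse.append p₃.reverse, fun e he => ?_⟩
    have n₁ : e ∈ p₁.edges → e ∉ q.edges := Walk.notMem_edges_of_forall_mem_support h₁
    have n₃ : e ∈ p₃.edges → e ∉ q.edges := Walk.notMem_edges_of_forall_mem_support h₃
    simp only [Walk.edges_append, Walk.edges_reverse, List.mem_append, List.mem_reverse] at he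
    rw [List.nodup_append', List.nodup_append'] at hnd
    have d₁ : e ∈ q₁.edges → e ∉ q₂.edges := fun h h' =>
      hnd.2.2 h (List.mem_append_left _ h')
    have d₃ : e ∈ q₂.edges → e ∉ q₃.edges := fun h h' => hnd.2.1.2.2 h h'
    rw [hpe e]
    rcases he with (h | h) | (h | h)
    · exact fun H => n₁ h (H.2 (.inl h))
    · have hq := (hqe e).2 (.inl h)
      exact fun H => (H.1 hq).elim (n₁ · hq) fun h' => h'.elim (d₁ h) (n₃ · hq)
    · have hq := (hqe e).2 (.inr (.inr h))
      exact fun H => (H.1 hq).elim (n₁ · hq) fun h' => h'.elim (d₃ · h) (n₃ · hq)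
    · exact fun H => n₃ h (H.2 (.inr (.inr h)))
  by_cases hb' : b ∈ (q.dropUntil a ha).support
  · exact .inl (key q hq ha hb' h₁ h₃)
  · right
    have ha' : a ∈ q.reverse.support := by simpa using ha
    have hba : b ∈ (q.takeUntil a ha).support := by
      rw [← q.take_spec ha, Walk.mem_support_append_iff] at hb
      exact hb.resolve_right hb'
    have hrev : q.reverse.dropUntil a ha' = (q.takeUntil a ha).reverse := by
      have e₁ : (q.reverse.dropUntil a ha').IsPath := hq.reverse.dropUntil ha'
      have e₂ : (q.takeUntil a ha).reverse.IsPath := (hq.takeUntil ha).reverse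
      exact congrArg Subtype.val ((hG.subsingleton_path _ _).elim ⟨_, e₁⟩ ⟨_, e₂⟩)
    obtain ⟨w₁, w₂, h⟩ := key q.reverse hq.reverse ha' (by rw [hrev]; simpa using hba)
      (by simpa using h₁) (by simpa using h₃)
    exact ⟨w₁, w₂, by simpa using h⟩

/-- If `u, v` and `s, t` are joined by the paths `p` and `q` of a forest `F` in `G`, then every
walk from `s` to `t` together with the symmetric difference of `p` and `q` contains a path
from `u` to `v`. -/
theorem IsAcyclic.exists_path_of_le {F : SimpleGraph V} (hF : F.IsAcyclic) (hFG : F ≤ G)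
    {u v s t : V} {p : F.Walk u v} {q : F.Walk s t} (hp : p.IsPath) (hq : q.IsPath)
    (r : G.Walk s t) :
    ∃ Q : G.Path u v, ∀ e ∈ Q.1.edges, e ∈ r.edges ∨ ¬ (e ∈ q.edges ↔ e ∈ p.edges) := by
  classical
  suffices ∃ Q : G.Walk u v, ∀ e ∈ Q.edges, e ∈ r.edges ∨ ¬ (e ∈ q.edges ↔ e ∈ p.edges) by
    obtain ⟨Q, hQ⟩ := this
    exact ⟨Q.toPath, fun e he => hQ e (Q.edges_toPath_subset_edges he)⟩
  by_cases h : ∃ x ∈ p.support, x ∈ q.support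
  · rcases hF.exists_walks_of_mem_support hp hq h with ⟨w₁, w₂, hw⟩ | ⟨w₁, w₂, hw⟩
    · refine ⟨(w₁.mapLe hFG).append (r.append (w₂.mapLe hFG)), fun e he => ?_⟩
      simp only [Walk.edges_append, Walk.edges_mapLe_eq_edges, List.mem_append] at he
      have := hw e
      tauto
    · refine ⟨(w₁.mapLe hFG).append (r.reverse.append (w₂.mapLe hFG)), fun e he => ?_⟩
      simp only [Walk.edges_append, Walk.edges_mapLe_eq_edges, List.mem_append,
        Walk.edges_reverse, List.mem_reverse] at he
      have := hw e
      tauto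
  · push Not at h
    refine ⟨p.mapLe hFG, fun e he => .inr ?_⟩
    rw [Walk.edges_mapLe_eq_edges] at he
    have : e ∉ q.edges := by
      refine Walk.notMem_edges_of_forall_mem_support (fun x hx hx' => ?_) he
      exact absurd hx' (h x hx)
    tauto

end SimpleGraph

/-! ### The potential and the bound for its minimizers -/

namespace NetworkDesignGame
variable {V : Type*} {n : ℕ} (Γ : NetworkDesignGame V n)

theorem mem_edges_iff {Γ : NetworkDesignGame V n} {P : Γ.Profile} {i : Fin n} {e : Sym2 V} :
    e ∈ Γ.edges P i ↔ e ∈ (P i).1.edges := by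
  simp [edges]

theorem cost_nonneg_of_mem_edges {P : Γ.Profile} {i : Fin n} {e : Sym2 V}
    (h : e ∈ Γ.edges P i) : 0 ≤ Γ.cost e :=
  Γ.cost_nonneg e ((P i).1.edges_subset_edgeSet (mem_edges_iff.1 h))

open Classical in
theorem load_eq_sum (P : Γ.Profile) (e : Sym2 V) :
    Γ.load P e = ∑ j, if e ∈ Γ.edges P j then 1 else 0 := by
  rw [load, Finset.card_filter]

theorem load_le (P : Γ.Profile) (e : Sym2 V) : Γ.load P e ≤ n := by
  classical
  exact (Finset.card_le_univ _).trans (by simp)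

theorem load_pos {P : Γ.Profile} {i : Fin n} {e : Sym2 V} (h : e ∈ Γ.edges P i) :
    0 < Γ.load P e :=
  Finset.card_pos.2 ⟨i, by simpa using h⟩

theorem exists_mem_edges_of_load_ne_zero {P : Γ.Profile} {e : Sym2 V} (h : Γ.load P e ≠ 0) :
    ∃ i, e ∈ Γ.edges P i := by
  obtain ⟨i, hi⟩ := Finset.card_pos.1 (Nat.pos_of_ne_zero h)
  exact ⟨i, by simpa using hi⟩

theorem cost_nonneg_of_load_ne_zero {P : Γ.Profile} {e : Sym2 V} (h : Γ.load P e ≠ 0) :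
    0 ≤ Γ.cost e :=
  let ⟨_, hi⟩ := Γ.exists_mem_edges_of_load_ne_zero h
  Γ.cost_nonneg_of_mem_edges hi

open Classical in
/-- Rosenthal's potential. -/
noncomputable def potential [Fintype V] (P : Γ.Profile) : ℝ :=
  ∑ e : Sym2 V, Γ.cost e * harmonic (Γ.load P e)

open Classical in
theorem socialCost_eq [Fintype V] (P : Γ.Profile) :
    Γ.socialCost P = ∑ e : Sym2 V, if Γ.load P e = 0 then 0 else Γ.cost e := by
  have h : ∀ i, Γ.playerCost P i =
      ∑ e : Sym2 V, if e ∈ Γ.edges P i then Γ.cost e / (Γ.load P e : ℝ) else 0 := by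
    intro i
    rw [playerCost, Finset.sum_ite_mem, Finset.univ_inter]
  simp_rw [socialCost, h]
  rw [Finset.sum_comm]
  refine Finset.sum_congr rfl fun e _ => ?_
  have h2 : ∑ i, (if e ∈ Γ.edges P i then Γ.cost e / (Γ.load P e : ℝ) else 0) =
      (Γ.load P e : ℝ) * (Γ.cost e / (Γ.load P e : ℝ)) := by
    rw [← Finset.sum_filter, Finset.sum_const, nsmul_eq_mul, load]
  rw [h2]
  split_ifs with h0
  · simp [h0]
  · field_simp

open Classical in
theorem potential_update_sub [Fintype V] (P : Γ.Profile) (i : Fin n)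
    (Q : Γ.graph.Path (Γ.source i) (Γ.target i)) :
    Γ.potential (Function.update P i Q) - Γ.potential P =
      Γ.playerCost (Function.update P i Q) i - Γ.playerCost P i := by
  set m : Sym2 V → ℕ := fun e => ∑ j ∈ Finset.univ.erase i, if e ∈ Γ.edges P j then 1 else 0
  -- The potential minus the cost of player `i` is the potential of the remaining players, which
  -- does not depend on the path of `i`.
  have key : ∀ R : Γ.Profile, (∀ j, j ≠ i → R j = P j) →
      Γ.potential R - Γ.playerCost R i = ∑ e : Sym2 V, Γ.cost e * harmonic (m e) := by
    intro R hR
    have hl : ∀ e, Γ.load R e = (if e ∈ Γ.edges R i then 1 else 0) + m e := by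
      intro e
      rw [load_eq_sum, ← Finset.add_sum_erase _ _ (Finset.mem_univ i)]
      congr 1
      refine Finset.sum_congr rfl fun j hj => ?_
      have : e ∈ Γ.edges R j ↔ e ∈ Γ.edges P j := by
        rw [mem_edges_iff, mem_edges_iff, hR j (Finset.ne_of_mem_erase hj)]
      simp only [this]
    have hc : Γ.playerCost R i =
        ∑ e : Sym2 V, if e ∈ Γ.edges R i then Γ.cost e / (Γ.load R e : ℝ) else 0 := by
      rw [playerCost, Finset.sum_ite_mem, Finset.univ_inter]
    rw [potential, hc, ← Finset.sum_sub_distrib]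
    refine Finset.sum_congr rfl fun e _ => ?_
    rw [hl e]
    split_ifs with he
    · rw [add_comm 1, harmonic_succ]
      push_cast
      ring
    · simp
  have h₁ := key (Function.update P i Q) fun j hj => Function.update_of_ne hj _ _
  have h₂ := key P fun _ _ => rfl
  linarith

/-- A minimizer of the potential. -/
theorem exists_isNash_forall_potential_le [Fintype V] :
    ∃ N : Γ.Profile, Γ.IsNash N ∧ ∀ P, Γ.potential N ≤ Γ.potential P := by
  classical
  have : Nonempty Γ.Profile := ⟨fun i => (Γ.reachable i).some.toPath⟩
  obtain ⟨N, hN⟩ := Finite.exists_min Γ.potential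
  refine ⟨N, fun i Q => ?_, hN⟩
  have := Γ.potential_update_sub N i Q
  linarith [hN (Function.update N i Q)]

/-- Every profile can be replaced by one in a forest that uses no additional edges. -/
theorem exists_forest (P : Γ.Profile) :
    ∃ F : SimpleGraph V, F.IsAcyclic ∧ F ≤ Γ.graph ∧
      ∃ q : ∀ i, F.Path (Γ.source i) (Γ.target i),
        ∀ i, ∀ e ∈ (q i).1.edges, ∃ j, e ∈ Γ.edges P j := by
  classical
  set D : SimpleGraph V := SimpleGraph.fromEdgeSet {e | ∃ j, e ∈ Γ.edges P j}
  have hD : ∀ e ∈ D.edgeSet, ∃ j, e ∈ Γ.edges P j := by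
    intro e he
    rw [SimpleGraph.edgeSet_fromEdgeSet] at he
    exact he.1
  obtain ⟨F, hFD, hF, hreach⟩ := D.exists_isAcyclic_reachable_eq_le
  have hDG : D ≤ Γ.graph := by
    rw [← SimpleGraph.edgeSet_subset_edgeSet]
    intro e he
    obtain ⟨j, hj⟩ := hD e he
    exact (P j).1.edges_subset_edgeSet (mem_edges_iff.1 hj)
  have hr : ∀ i, F.Reachable (Γ.source i) (Γ.target i) := by
    intro i
    rw [hreach]
    refine ⟨(P i).1.transfer D fun e he => ?_⟩
    rw [SimpleGraph.edgeSet_fromEdgeSet]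
    exact ⟨⟨i, mem_edges_iff.2 he⟩,
      Γ.graph.not_isDiag_of_mem_edgeSet ((P i).1.edges_subset_edgeSet he)⟩
  refine ⟨F, hF, hFD.trans hDG, fun i => (hr i).some.toPath, fun i e he => ?_⟩
  exact hD e (SimpleGraph.edgeSet_mono hFD (SimpleGraph.Walk.edges_subset_edgeSet _ he))

open Classical in
/-- If every player other than `i` may switch to a detour along the path of player `i` in `N`, then
the potential of `N` is bounded by that of the resulting profile. -/
theorem potential_le_of_detours [Fintype V] {N O : Γ.Profile}
    (hN : ∀ P, Γ.potential N ≤ Γ.potential P) (i : Fin n)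
    (hQ : ∀ j, ∃ Q : Γ.graph.Path (Γ.source j) (Γ.target j), ∀ e ∈ Q.1.edges,
      e ∈ Γ.edges N i ∨ ¬ (e ∈ Γ.edges O i ↔ e ∈ Γ.edges O j)) :
    Γ.potential N ≤ ∑ e : Sym2 V, ((if e ∈ Γ.edges N i then Γ.cost e * harmonic n else 0) +
      Γ.cost e * (if e ∈ Γ.edges O i then (harmonic (n - Γ.load O e) : ℝ)
        else harmonic (Γ.load O e))) := by
  choose Q hQ using hQ
  refine (hN Q).trans (Finset.sum_le_sum fun e _ => ?_)
  have hR : 0 ≤ Γ.cost e * (if e ∈ Γ.edges O i then (harmonic (n - Γ.load O e) : ℝ)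
      else harmonic (Γ.load O e)) := by
    split_ifs with h
    · exact mul_nonneg (Γ.cost_nonneg_of_mem_edges h)
        (by simpa using harmonic_le_harmonic (Nat.zero_le _))
    · by_cases h0 : Γ.load O e = 0
      · simp [h0]
      · exact mul_nonneg (Γ.cost_nonneg_of_load_ne_zero h0)
          (by simpa using harmonic_le_harmonic (Nat.zero_le _))
  -- All players may cross the path of `i` in `N`, so only the trivial bound `n` on the load is used
  -- there.
  by_cases hN : e ∈ Γ.edges N i
  · rw [if_pos hN]
    have := mul_le_mul_of_nonneg_left (harmonic_le_harmonic (Γ.load_le Q e))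
      (Γ.cost_nonneg_of_mem_edges hN)
    linarith
  rw [if_neg hN, zero_add]
  by_cases h0 : Γ.load Q e = 0
  · simpa [h0] using hR
  refine mul_le_mul_of_nonneg_left ?_ (Γ.cost_nonneg_of_load_ne_zero h0)
  have hQ' : ∀ j, e ∈ Γ.edges Q j → ¬ (e ∈ Γ.edges O i ↔ e ∈ Γ.edges O j) := fun j hj =>
    (hQ j e (mem_edges_iff.1 hj)).resolve_left hN
  split_ifs with h
  · refine harmonic_le_harmonic ?_
    have h2 : (Finset.univ.filter fun j => e ∈ Γ.edges Q j) ⊆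
        (Finset.univ.filter fun j => e ∈ Γ.edges O j)ᶜ := by
      intro j hj
      have := hQ' j (by simpa using hj)
      simpa [h] using this
    have h3 := Finset.card_le_card h2
    rwa [Finset.card_compl, Fintype.card_fin] at h3
  · refine harmonic_le_harmonic (Finset.card_le_card fun j hj => ?_)
    have := hQ' j (by simpa using hj)
    simpa [h] using this

open Classical in
theorem sum_ite_mem_edges (P : Γ.Profile) (e : Sym2 V) (a b : ℝ) :
    ∑ i, (if e ∈ Γ.edges P i then a else b) = Γ.load P e * a + (n - Γ.load P e) * b := by
  have hl : (Γ.load P e : ℝ) = ∑ j, if e ∈ Γ.edges P j then (1 : ℝ) else 0 := by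
    rw [load_eq_sum]; push_cast; rfl
  have : ∀ i, (if e ∈ Γ.edges P i then a else b) =
      (if e ∈ Γ.edges P i then (1 : ℝ) else 0) * (a - b) + b := by
    intro i; split_ifs <;> ring
  simp_rw [this]
  rw [Finset.sum_add_distrib, ← Finset.sum_mul, ← hl]
  simp
  ring

/-- The bound on the cost of a potential minimizer by that of a profile in a forest. -/
theorem mul_socialCost_le_of_detours [Fintype V] (hn : 2 ≤ n) {N O : Γ.Profile}
    (hN : ∀ P, Γ.potential N ≤ Γ.potential P)
    (hQ : ∀ i j, ∃ Q : Γ.graph.Path (Γ.source j) (Γ.target j), ∀ e ∈ Q.1.edges,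
      e ∈ Γ.edges N i ∨ ¬ (e ∈ Γ.edges O i ↔ e ∈ Γ.edges O j)) :
    (n + shift n - harmonic n) * Γ.socialCost N ≤
      (n + shift n) * realHarmonic ((n + shift n) / 2) * Γ.socialCost O := by
  classical
  have hx := shift_nonneg hn
  have h₁ := Finset.sum_le_sum fun i (_ : i ∈ Finset.univ) =>
    Γ.potential_le_of_detours hN i (hQ i)
  rw [Finset.sum_comm] at h₁
  simp only [Finset.sum_const, Finset.card_univ, Fintype.card_fin, nsmul_eq_mul,
    Finset.sum_add_distrib, ← Finset.mul_sum, sum_ite_mem_edges, mul_zero, add_zero] at h₁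
  -- The extra `shift n` copies of the potential inequality keep the coefficient of fully shared
  -- edges of `N` positive.
  have h₂ := mul_le_mul_of_nonneg_left (hN O) hx
  have h₃ : (n + shift n - harmonic n) * Γ.socialCost N ≤
      (n + shift n) * Γ.potential N -
        ∑ e, (Γ.load N e : ℝ) * (Γ.cost e * harmonic n) := by
    rw [socialCost_eq, potential, Finset.mul_sum, Finset.mul_sum, ← Finset.sum_sub_distrib]
    refine Finset.sum_le_sum fun e _ => ?_
    split_ifs with h0
    · simp [h0]
    · have := mul_le_mul_of_nonneg_right (add_shift_sub_harmonic_le hn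
        (Nat.one_le_iff_ne_zero.2 h0) (Γ.load_le N e)) (Γ.cost_nonneg_of_load_ne_zero h0)
      linarith
  have h₄ : shift n * Γ.potential O + ∑ e, Γ.cost e *
        (Γ.load O e * (harmonic (n - Γ.load O e) : ℝ) +
          (n - Γ.load O e) * harmonic (Γ.load O e)) ≤
      (n + shift n) * realHarmonic ((n + shift n) / 2) * Γ.socialCost O := by
    rw [socialCost_eq, potential, Finset.mul_sum, Finset.mul_sum, ← Finset.sum_add_distrib]
    refine Finset.sum_le_sum fun e _ => ?_
    split_ifs with h0
    · simp [h0]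
    · have hle := Γ.load_le O e
      have := mul_le_mul_of_nonneg_right (mul_realHarmonic_add_mul_realHarmonic_le
        (k := Γ.load O e) (n := n) (Nat.cast_nonneg _) (by exact_mod_cast hle) hx)
        (Γ.cost_nonneg_of_load_ne_zero h0)
      rw [← Nat.cast_sub hle, realHarmonic_natCast, realHarmonic_natCast] at this
      linarith
  linarith

theorem exists_isNash_forall_mul_socialCost_le [Finite V] (hn : 2 ≤ n) :
    ∃ N : Γ.Profile, Γ.IsNash N ∧ ∀ P, (n + shift n - harmonic n) * Γ.socialCost N ≤
      (n + shift n) * realHarmonic ((n + shift n) / 2) * Γ.socialCost P := by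
  classical
  have := Fintype.ofFinite V
  obtain ⟨N, hNash, hN⟩ := Γ.exists_isNash_forall_potential_le
  refine ⟨N, hNash, fun P => ?_⟩
  obtain ⟨F, hF, hFG, q, hq⟩ := Γ.exists_forest P
  let O : Γ.Profile := fun i => ⟨(q i).1.mapLe hFG, (q i).2.mapLe hFG⟩
  have hO : ∀ i e, e ∈ Γ.edges O i ↔ e ∈ (q i).1.edges := by
    intro i e
    rw [mem_edges_iff, SimpleGraph.Walk.edges_mapLe_eq_edges]
  have hx := shift_nonneg hn
  refine (Γ.mul_socialCost_le_of_detours hn hN (O := O) fun i j => ?_).trans ?_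
  · simp only [hO, mem_edges_iff (P := N)]
    exact hF.exists_path_of_le hFG (q j).2 (q i).2 (N i).1
  · refine mul_le_mul_of_nonneg_left ?_ (mul_nonneg (by positivity)
      (realHarmonic_nonneg (by positivity)))
    rw [socialCost_eq, socialCost_eq]
    refine Finset.sum_le_sum fun e _ => ?_
    split_ifs with h₁ h₂ h₂
    · exact le_rfl
    · exact Γ.cost_nonneg_of_load_ne_zero h₂
    · obtain ⟨i, hi⟩ := Γ.exists_mem_edges_of_load_ne_zero h₁
      obtain ⟨j, hj⟩ := hq i e ((hO i e).1 hi)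
      exact absurd h₂ (Γ.load_pos hj).ne'
    · exact le_rfl

theorem priceOfStability_le [Finite V] (hn : 2 ≤ n) :
    Γ.priceOfStability ≤ ENNReal.ofReal ((n + shift n) / (n + shift n - harmonic n) *
      realHarmonic ((n + shift n) / 2)) := by
  classical
  have := Fintype.ofFinite V
  obtain ⟨N, hNash, hN⟩ := Γ.exists_isNash_forall_mul_socialCost_le hn
  have : Nonempty Γ.Profile := ⟨N⟩
  obtain ⟨P, hP⟩ := Finite.exists_min fun P : Γ.Profile => ENNReal.ofReal (Γ.socialCost P)
  have hpos := add_shift_sub_harmonic_pos hn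
  have hx := shift_nonneg hn
  refine ENNReal.div_le_of_le_mul ?_
  have h₁ : (⨅ P : Γ.Profile, ENNReal.ofReal (Γ.socialCost P)) =
      ENNReal.ofReal (Γ.socialCost P) := le_antisymm (iInf_le _ P) (le_iInf hP)
  rw [h₁, ← ENNReal.ofReal_mul (mul_nonneg (by positivity) (realHarmonic_nonneg (by positivity)))]
  refine (iInf₂_le N hNash).trans (ENNReal.ofReal_le_ofReal ?_)
  rw [div_mul_eq_mul_div, div_mul_eq_mul_div, le_div_iff₀ hpos, mul_comm]
  exact hN P

end NetworkDesignGame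

theorem PoS_le {n : ℕ} (hn : 2 ≤ n) :
    PoS.{u} n ≤ ENNReal.ofReal ((n + shift n) / (n + shift n - harmonic n) *
      realHarmonic ((n + shift n) / 2)) :=
  iSup_le fun _ => iSup_le fun _ => iSup_le fun Γ => Γ.priceOfStability_le hn

/-! ### Asymptotics of the bound -/

theorem shift_le {n : ℕ} (hn : 2 ≤ n) : shift n ≤ n / ((harmonic n : ℝ) - 1) := by
  have := one_lt_harmonic hn
  exact div_le_div_of_nonneg_right (by linarith) (by linarith)

/-- The first error term pays for replacing (n + x)/2 by n/2 in H, the second for the factor (n +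
x)/(n + x - H_n). -/
theorem bound_le_realHarmonic_half_add {n : ℕ} (hn : 2 ≤ n) (hh : (2 : ℝ) ≤ harmonic n)
    (hlt : (harmonic n : ℝ) < n) :
    (n + shift n) / (n + shift n - harmonic n) * realHarmonic ((n + shift n) / 2) ≤
      realHarmonic (n / 2) + (1 / ((harmonic n : ℝ) - 1) +
        (harmonic n : ℝ) ^ 2 / (n - harmonic n)) := by
  have hx := shift_nonneg hn
  have hx' := shift_le hn
  have hn' : (2 : ℝ) ≤ n := by exact_mod_cast hn
  set h : ℝ := (harmonic n : ℝ) with hdef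
  set x := shift n
  have hxn : x ≤ n := hx'.trans (div_le_self (by linarith) (by linarith))
  have h₁ : realHarmonic ((n + x) / 2) ≤ realHarmonic (n / 2) + 1 / (h - 1) := by
    have := realHarmonic_add_le (y := n / 2) (d := x / 2) (by linarith) (by linarith)
    rw [← add_div] at this
    refine this.trans (add_le_add_right ?_ _)
    rw [div_div_div_cancel_right₀ two_ne_zero, div_le_iff₀ (by linarith)]
    refine hx'.trans (le_of_eq (by ring))
  have h₂ : realHarmonic ((n + x) / 2) ≤ h := by
    rw [hdef, ← realHarmonic_natCast]
    exact realHarmonic_mono (by linarith) (by linarith)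
  have h₃ : (n + x) / (n + x - h) = 1 + h / (n + x - h) := by
    have : (n : ℝ) + x - h ≠ 0 := by linarith
    field_simp
    ring
  have h₄ : h / (n + x - h) * realHarmonic ((n + x) / 2) ≤ h / (n - h) * h :=
    mul_le_mul (div_le_div_of_nonneg_left (by linarith) (by linarith) (by linarith)) h₂
      (realHarmonic_nonneg (by linarith)) (div_nonneg (by linarith) (by linarith))
  have h₅ : h / (n - h) * h = h ^ 2 / (n - h) := by ring
  rw [h₃, add_mul, one_mul]
  linarith

open Filter Asymptotics in
theorem eventually_harmonic_sq_le {c : ℝ} (hc : 0 < c) :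
    ∀ᶠ n : ℕ in atTop, (harmonic n : ℝ) ^ 2 ≤ c * n := by
  -- The 4 in `c / 4` comes from H_n ≤ 1 + log n ≤ 2 log n.
  have h₁ := (tendsto_natCast_atTop_atTop (R := ℝ)).eventually
    ((Real.isLittleO_pow_log_id_atTop (n := 2)).bound (by positivity : 0 < c / 4))
  have h₂ := (Real.tendsto_log_atTop.comp
    (tendsto_natCast_atTop_atTop (R := ℝ))).eventually_ge_atTop 1
  filter_upwards [h₁, h₂] with n h₁ h₂
  simp only [Function.comp_apply, id, norm_pow, Real.norm_eq_abs, sq_abs, Nat.abs_cast] at h₁ h₂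
  have h₃ := harmonic_le_one_add_log n
  have h₄ : (0 : ℝ) ≤ harmonic n := by
    rw [← realHarmonic_natCast]
    exact realHarmonic_nonneg n.cast_nonneg
  nlinarith

open Filter in
theorem tendsto_harmonic_atTop : Tendsto (fun n : ℕ => (harmonic n : ℝ)) atTop atTop := by
  refine tendsto_atTop_mono (fun n => log_add_one_le_harmonic n) ?_
  have := (Real.tendsto_log_atTop.comp (tendsto_natCast_atTop_atTop (R := ℝ))).comp
    (tendsto_add_atTop_nat 1)
  simpa [Function.comp_def] using this

open Filter in
theorem eventually_bound_le {ε : ℝ} (hε : 0 < ε) :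
    ∀ᶠ n : ℕ in atTop, (n + shift n) / (n + shift n - harmonic n) *
      realHarmonic ((n + shift n) / 2) ≤ realHarmonic (n / 2) + ε := by
  -- The bound H_n² ≤ n with H_n ≥ 2 gives n - H_n ≥ n/2; then H_n² ≤ (ε/4) n makes the second error
  -- term at most ε/2.
  have hc : 0 < min 1 (ε / 4) := by positivity
  filter_upwards [eventually_ge_atTop 2, tendsto_harmonic_atTop.eventually_ge_atTop 2,
    tendsto_harmonic_atTop.eventually_ge_atTop (2 / ε + 1), eventually_harmonic_sq_le hc]
    with n hn hh hε' hsq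
  have hn' : (2 : ℝ) ≤ n := by exact_mod_cast hn
  have h₁ : (harmonic n : ℝ) ^ 2 ≤ n :=
    hsq.trans ((mul_le_mul_of_nonneg_right (min_le_left _ _) (by linarith)).trans_eq (one_mul _))
  have h₂ : (harmonic n : ℝ) ^ 2 ≤ ε / 4 * n :=
    hsq.trans (mul_le_mul_of_nonneg_right (min_le_right _ _) (by linarith))
  have h₃ : (harmonic n : ℝ) ≤ n / 2 := by nlinarith
  refine (bound_le_realHarmonic_half_add hn hh (by linarith)).trans (add_le_add_right ?_ _)
  have h₄ : 1 / ((harmonic n : ℝ) - 1) ≤ ε / 2 := by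
    rw [div_le_iff₀ (by linarith)]
    calc (1 : ℝ) = ε / 2 * (2 / ε) := by field_simp
      _ ≤ _ := mul_le_mul_of_nonneg_left (by linarith) (by linarith)
  have h₅ : (harmonic n : ℝ) ^ 2 / (n - harmonic n) ≤ ε / 2 := by
    rw [div_le_iff₀ (by linarith)]
    nlinarith
  linarith

theorem theorem1 :
    (∀ ε : ℝ, 0 < ε → ∃ n₀ : ℕ, ∀ n : ℕ, n₀ ≤ n →
      PoS.{u} n ≤ ENNReal.ofReal (realHarmonic ((n : ℝ) / 2) + ε)) ∧
    (∀ n : ℕ, 2 ≤ n →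
      PoS.{u} n ≤ ENNReal.ofReal
        (((n : ℝ) + shift n) / ((n : ℝ) + shift n - (harmonic n : ℝ)) *
          realHarmonic (((n : ℝ) + shift n) / 2))) := by
  refine ⟨fun ε hε => ?_, fun n hn => PoS_le hn⟩
  obtain ⟨n₀, h⟩ := Filter.eventually_atTop.1 (eventually_bound_le hε)
  exact ⟨max n₀ 2, fun n hn => (PoS_le (le_of_max_le_right hn)).trans
    (ENNReal.ofReal_le_ofReal (h n (le_of_max_le_left hn)))⟩
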